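/- Let $\mathcal{C}$ be a $\mathbb{C}$-linear abelian rigid monoidal category (with $\mathbb{C}$-bilinear tensor product), and let $(X,m,e,\delta,\epsilon)$ be a Frobenius algebra in $\mathcal{C}$ whose underlying object is semisimple of finite length, i.e. a finite direct sum of simple objects; assume, as is implicit in the use of Schur's lemma, that $\mathrm{End}(S)=\mathbb{C}\,\mathrm{id}_S$ for every simple quotient $S$ of $X$. Duals are written $(V^*,\ \mathrm{ev}_V:V^*\otimes V\to\mathbf 1,\ \mathrm{coev}_V:\mathbf 1\to V\otimes V^*)$. For a Frobenius algebra $A$ one takes $A^*=A$, $\mathrm{ev}_A=\epsilon_A\circ m_A$, $\mathrm{coev}_A=\delta_A\circ e_A$; thus a morphism $f:A\to B$ of $\mathcal{C}$ between Frobenius algebras has a dual $f^*:B\to A$. A Frobenius subalgebra of $X$ is a Frobenius algebra $A$ together with a monomorphism of unital algebras $i:A\to X$ such that $i^{**}=i$ and $i^*\circ i=\mathrm{id}_A$. Two Frobenius subalgebras $(A_1,i_1)$, $(A_2,i_2)$ are equivalent if there is an isomorphism $f:A_1\to A_2$ with $i_1=i_2\circ f$, $i_2=i_1\circ f^*$,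 $f^*\circ f=\mathrm{id}$ and $f\circ f^*=\mathrm{id}$; the class $[A_1]$ is contained in $[A_2]$ if there is a monomorphism $f:A_1\to A_2$ with $i_1=i_2\circ f$ and $f^*\circ f=\mathrm{id}$. Let $\mathcal{O}(\mathcal{C})$ be a set of representatives of the isomorphism classes of simple objects, and let $\mathcal{B}$ be a basis of $X$, i.e. a family consisting of a basis $\mathcal{B}_S$ of $\mathrm{Hom}(X,S)$ for each $S\in\mathcal{O}(\mathcal{C})$. For $f\in\mathrm{Hom}(X,S)$ and $g\in\mathrm{Hom}(X^*,S^*)=\mathrm{Hom}(X,S^*)$ define $\kappa'_S(f,g)\in\mathbb{C}$ by $(f\otimes g)\circ\mathrm{coev}_X=\kappa'_S(f,g)\,\mathrm{coev}_S$, and define the conjugate-linear map $M'_S:\mathrm{Hom}(X^*,S^*)\to\mathrm{Hom}(X,S)$ by $\langle f,M'_S g\rangle=\kappa'_S(f,g)$ for all $f$, where $\langle\cdot,\cdot\rangle$ is the Hermitian form on $\mathrm{Hom}(X,S)$, conjugate-linear in the second argument, for which $\mathcal{B}_S$ is orthonormal. A Frobenius subalgebra $(A,i)$ is $\mathcal{B}$-rigid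 invariant if $$M'_S\bigl(\mathrm{Hom}(A^*,S^*)\circ i^*\bigr)=\mathrm{Hom}(A,S)\circ i^*\qquad\text{for all } S\in\mathcal{O}(\mathcal{C}).$$ Then for every basis $\mathcal{B}$ of $X$ the poset of equivalence classes of $\mathcal{B}$-rigid invariant Frobenius subalgebras of $X$, ordered by containment, is a lattice: every two elements have an infimum and a supremum. The meet is given by intersection: if $(A,i_A)$ and $(B,i_B)$ are $\mathcal{B}$-rigid invariant Frobenius subalgebras and $A\cap B$ is the pullback of $i_A$ and $i_B$, with projection $j_A:A\cap B\to A$, then $A\cap B$ carries a Frobenius algebra structure for which $(A\cap B,\ i_A\circ j_A)$ is a $\mathcal{B}$-rigid invariant Frobenius subalgebra of $X$, and $[A]\wedge[B]=[A\cap B]$. -/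

import Mathlib

open CategoryTheory MonoidalCategory

universe w' w v u

noncomputable section

namespace FrobLattice

open scoped MonObj ComonObj

section Monoidal

variable {C : Type u} [Category.{v} C] [MonoidalCategory C]

/-- A Frobenius algebra `(X, m, e, δ, ε)` in a monoidal category: a unital algebra and a counital
coalgebra with `(id ⊗ m) ∘ (δ ⊗ id) = δ ∘ m = (m ⊗ id) ∘ (id ⊗ δ)`. -/
class FrobeniusAlgebra (X : C) extends MonObj X, ComonObj X where
  frobenius_left : Δ[X] ▷ X ≫ (α_ X X X).hom ≫ X ◁ μ[X] = μ[X] ≫ Δ[X]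
  frobenius_right : X ◁ Δ[X] ≫ (α_ X X X).inv ≫ μ[X] ▷ X = μ[X] ≫ Δ[X]

/-- A Frobenius algebra is its own dual, with `ev = ε ∘ m` and `coev = δ ∘ e`. This is the
duality that is used for Frobenius algebras. -/
instance FrobeniusAlgebra.exactPairing (X : C) [FrobeniusAlgebra X] : ExactPairing X X where
  coevaluation' := η[X] ≫ Δ[X]
  evaluation' := μ[X] ≫ ε[X]
  coevaluation_evaluation' := by
    have h := FrobeniusAlgebra.frobenius_right (X := X)
    calc _ = X ◁ η[X] ≫ (X ◁ Δ[X] ≫ (α_ X X X).inv ≫ μ[X] ▷ X) ≫ ε[X] ▷ X := by simp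
      _ = _ := by rw [h]; simp
  evaluation_coevaluation' := by
    have h := FrobeniusAlgebra.frobenius_left (X := X)
    calc _ = η[X] ▷ X ≫ (Δ[X] ▷ X ≫ (α_ X X X).hom ≫ X ◁ μ[X]) ≫ X ◁ ε[X] := by simp
      _ = _ := by rw [h]; simp

/-- The dual morphism `f* : X* → A*` of `f : A → X`, for chosen duals `A' = A*`, `X' = X*` with
`ev : A' ⊗ A → 𝟙`, `coev : 𝟙 → A ⊗ A'`, namely
`f* = (ev_X ⊗ id) ∘ (id ⊗ f ⊗ id) ∘ (id ⊗ coev_A)`. -/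
def dualMap {A A' X X' : C} [ExactPairing A A'] [ExactPairing X X'] (f : A ⟶ X) : X' ⟶ A' :=
  (ρ_ X').inv ≫ X' ◁ η_ A A' ≫ X' ◁ f ▷ A' ≫ (α_ X' X A').inv ≫ ε_ X X' ▷ A' ≫ (λ_ A').hom

lemma dualMap_eq {A A' X X' : C} [a : ExactPairing A A'] [x : ExactPairing X X'] (f : A ⟶ X) :
    (dualMap f : X' ⟶ A') =
      @rightAdjointMate C _ _ A X (@HasRightDual.mk C _ _ A A' a) (@HasRightDual.mk C _ _ X X' x) f :=
  rfl

lemma dualMap_id {A A' : C} [a : ExactPairing A A'] : (dualMap (𝟙 A) : A' ⟶ A') = 𝟙 A' := by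
  rw [dualMap_eq]
  exact @rightAdjointMate_id C _ _ A (@HasRightDual.mk C _ _ A A' a)

lemma dualMap_comp {A A' X X' Y Y' : C} [a : ExactPairing A A'] [x : ExactPairing X X']
    [y : ExactPairing Y Y'] (f : A ⟶ X) (g : X ⟶ Y) :
    (dualMap (f ≫ g) : Y' ⟶ A') = (dualMap g : Y' ⟶ X') ≫ (dualMap f : X' ⟶ A') := by
  rw [dualMap_eq, dualMap_eq, dualMap_eq]
  exact @comp_rightAdjointMate C _ _ A X Y (@HasRightDual.mk C _ _ A A' a)
    (@HasRightDual.mk C _ _ X X' x) (@HasRightDual.mk C _ _ Y Y' y) f g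

/-- The dual `f* : X → A` of a morphism `f : A → X` of Frobenius algebras, with respect to
`A* = A` and `X* = X`. -/
abbrev dualHom {A X : C} [FrobeniusAlgebra A] [FrobeniusAlgebra X] (f : A ⟶ X) : X ⟶ A :=
  dualMap f

/-- `i : A → X` exhibits the Frobenius algebra `A` as a Frobenius subalgebra of `X`: it is a
monomorphism of unital algebras with `i** = i` and `i* ∘ i = id`. -/
structure IsFrobeniusInclusion {A X : C} [FrobeniusAlgebra A] [FrobeniusAlgebra X]
    (i : A ⟶ X) : Prop where
  mono : Mono i
  isMonHom : IsMonHom i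
  dual_dual : dualHom (dualHom i) = i
  comp_dual : i ≫ dualHom i = 𝟙 A

/-- A Frobenius subalgebra of `X` (before passing to equivalence classes). -/
structure FrobeniusSubalgebra (X : C) [FrobeniusAlgebra X] where
  obj : C
  [frob : FrobeniusAlgebra obj]
  incl : obj ⟶ X
  isIncl : IsFrobeniusInclusion incl

attribute [instance] FrobeniusSubalgebra.frob

namespace FrobeniusSubalgebra

variable {X : C} [FrobeniusAlgebra X]

/-- Equivalence of Frobenius subalgebras. -/
def Equivalent (A B : FrobeniusSubalgebra X) : Prop :=
  ∃ f : A.obj ≅ B.obj, A.incl = f.hom ≫ B.incl ∧ B.incl = dualHom f.hom ≫ A.incl ∧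
    f.hom ≫ dualHom f.hom = 𝟙 A.obj ∧ dualHom f.hom ≫ f.hom = 𝟙 B.obj

/-- Containment of Frobenius subalgebras. -/
def Contained (A B : FrobeniusSubalgebra X) : Prop :=
  ∃ f : A.obj ⟶ B.obj, Mono f ∧ A.incl = f ≫ B.incl ∧ f ≫ dualHom f = 𝟙 A.obj

lemma contained_refl (A : FrobeniusSubalgebra X) : A.Contained A :=
  ⟨𝟙 _, inferInstance, by simp, by simp [dualHom, dualMap_id]⟩

lemma Contained.trans {A B D : FrobeniusSubalgebra X} (h : A.Contained B) (h' : B.Contained D) :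
    A.Contained D := by
  obtain ⟨f, hf, e, s⟩ := h
  obtain ⟨g, hg, e', s'⟩ := h'
  refine ⟨f ≫ g, mono_comp f g, by rw [e, e', Category.assoc], ?_⟩
  have : dualHom (f ≫ g) = dualHom g ≫ dualHom f := dualMap_comp f g
  rw [this, Category.assoc, reassoc_of% s', s]

lemma Equivalent.contained {A B : FrobeniusSubalgebra X} (h : A.Equivalent B) :
    A.Contained B := by
  obtain ⟨f, e, _, s, _⟩ := h
  exact ⟨f.hom, inferInstance, e, s⟩

lemma Contained.antisymm {A B : FrobeniusSubalgebra X} (h : A.Contained B)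
    (h' : B.Contained A) : A.Equivalent B := by
  obtain ⟨f, hf, e, s⟩ := h
  obtain ⟨g, hg, e', s'⟩ := h'
  have := A.isIncl.mono
  have := B.isIncl.mono
  have fg : f ≫ g = 𝟙 _ := by
    rw [← cancel_mono A.incl, Category.assoc, ← e', ← e, Category.id_comp]
  have gf : g ≫ f = 𝟙 _ := by
    rw [← cancel_mono B.incl, Category.assoc, ← e, ← e', Category.id_comp]
  have hs : dualHom f = g := by
    rw [← Category.id_comp (dualHom f), ← gf, Category.assoc, s, Category.comp_id]
  exact ⟨⟨f, g, fg, gf⟩, e, by rw [hs]; exact e', s, by rw [hs]; exact gf⟩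

lemma Equivalent.contained' {A B : FrobeniusSubalgebra X} (h : A.Equivalent B) :
    B.Contained A := by
  obtain ⟨f, e, e', s, s'⟩ := h
  have hA := A.isIncl
  have hB := B.isIncl
  have := hA.mono
  have := hB.mono
  have hf : dualHom (dualHom f.hom) = f.hom := by
    rw [← cancel_mono B.incl, ← e]
    conv_lhs => rw [← hB.dual_dual]
    conv_rhs => rw [← hA.dual_dual, e]
    have h1 : dualHom (f.hom ≫ B.incl) = dualHom B.incl ≫ dualHom f.hom := dualMap_comp _ _
    have h2 : dualHom (dualHom B.incl ≫ dualHom f.hom) = dualHom (dualHom f.hom) ≫ dualHom (dualHom B.incl) :=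
      dualMap_comp _ _
    rw [h1, h2]
  have : IsIso (dualHom f.hom) := ⟨f.hom, s', s⟩
  exact ⟨dualHom f.hom, inferInstance, e', by rw [hf, s']⟩

instance setoid (X : C) [FrobeniusAlgebra X] : Setoid (FrobeniusSubalgebra X) where
  r := Equivalent
  iseqv :=
    { refl := fun A => (contained_refl A).antisymm (contained_refl A)
      symm := fun h => h.contained'.antisymm h.contained
      trans := fun h h' => (h.contained.trans h'.contained).antisymm
        (h'.contained'.trans h.contained') }

end FrobeniusSubalgebra

/-- The Frobenius subalgebra poset of `X`: Frobenius subalgebras up to equivalence, ordered by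
containment. -/
def FrobeniusSubalgebraPoset (X : C) [FrobeniusAlgebra X] : Type max u v :=
  Quotient (FrobeniusSubalgebra.setoid X)

instance (X : C) [FrobeniusAlgebra X] : PartialOrder (FrobeniusSubalgebraPoset X) where
  le := Quotient.lift₂ FrobeniusSubalgebra.Contained (fun _ _ _ _ h h' => propext
    ⟨fun k => (h.contained'.trans k).trans h'.contained,
      fun k => (h.contained.trans k).trans h'.contained'⟩)
  le_refl := by
    rintro ⟨a⟩
    exact a.contained_refl
  le_trans := by
    rintro ⟨a⟩ ⟨b⟩ ⟨c⟩ h h'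
    exact FrobeniusSubalgebra.Contained.trans h h'
  le_antisymm := by
    rintro ⟨a⟩ ⟨b⟩ h h'
    exact Quotient.sound (FrobeniusSubalgebra.Contained.antisymm h h')

/-- The equivalence class of a Frobenius subalgebra. -/
def FrobeniusSubalgebra.toPoset {X : C} [FrobeniusAlgebra X] (A : FrobeniusSubalgebra X) :
    FrobeniusSubalgebraPoset X :=
  Quotient.mk _ A

lemma FrobeniusSubalgebra.Contained.factors {X S : C} [FrobeniusAlgebra X]
    {A B : FrobeniusSubalgebra X} (h : A.Contained B) (f : X ⟶ S)
    (hf : ∃ t : A.obj ⟶ S, f = dualHom A.incl ≫ t) : ∃ t : B.obj ⟶ S, f = dualHom B.incl ≫ t := by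
  obtain ⟨k, _, e, _⟩ := h
  obtain ⟨t, rfl⟩ := hf
  refine ⟨dualHom k ≫ t, ?_⟩
  have : dualHom (k ≫ B.incl) = dualHom B.incl ≫ dualHom k := dualMap_comp _ _
  rw [e, this, Category.assoc]

end Monoidal

/-- A set of representatives of the isomorphism classes of simple objects. -/
structure SimpleReps (C : Type u) [Category.{v} C] [Limits.HasZeroMorphisms C] where
  idx : Type w
  obj : idx → C
  simple : ∀ s, Simple (obj s)
  eq_of_iso : ∀ s t, Nonempty (obj s ≅ obj t) → s = t
  exists_iso : ∀ S : C, Simple S → ∃ s, Nonempty (S ≅ obj s)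

section Linear

variable {C : Type u} [Category.{v} C] [Preadditive C] [Linear ℂ C]

/-- A basis of an object `X`: a (finite) basis of the multiplicity space `Hom(X, S)` for every
representative `S` of the simple objects. -/
structure ObjectBasis (R : SimpleReps.{w} C) (X : C) where
  ix : R.idx → Type w'
  [fintype : ∀ s, Fintype (ix s)]
  basis : ∀ s, Module.Basis (ix s) ℂ (X ⟶ R.obj s)

attribute [instance] ObjectBasis.fintype

/-- The Hermitian form on a complex vector space, conjugate-linear in the second argument, for
which the given basis is orthonormal. -/
def hermitian {J V : Type*} [Fintype J] [AddCommGroup V] [Module ℂ V]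
    (b : Module.Basis J ℂ V) (f h : V) : ℂ :=
  ∑ j, b.repr f j * (starRingEnd ℂ) (b.repr h j)

variable [MonoidalCategory C]

/-- The scalar `κ'(f, g)` with `(f ⊗ g) ∘ coev_X = κ'(f, g) • coev_S`, for `f : X → S` and
`g : X* → S*`, where `X' = X*` and `S' = S*`. -/
def copairing {X X' S S' : C} [ExactPairing X X'] [ExactPairing S S']
    (f : X ⟶ S) (g : X' ⟶ S') : ℂ :=
  Classical.epsilon fun c : ℂ => η_ X X' ≫ (f ⊗ₘ g) = c • η_ S S'

/-- The conjugate-linear map `M' : Hom(X*, S*) → Hom(X, S)` which is determined by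
`⟨f, M' g⟩ = κ'(f, g)`, where the given basis of `Hom(X, S)` is orthonormal. -/
def conjDual {X X' S S' : C} [ExactPairing X X'] [ExactPairing S S'] {J : Type*} [Fintype J]
    (b : Module.Basis J ℂ (X ⟶ S)) (g : X' ⟶ S') : X ⟶ S :=
  ∑ j, (starRingEnd ℂ) (copairing (b j) g) • b j

section Spec

variable [MonoidalPreadditive C] [MonoidalLinear ℂ C]

/-- The defining property of `κ'`, for a simple object with scalar endomorphisms. -/
lemma copairing_spec {X X' S S' : C} [ExactPairing X X'] [ExactPairing S S']
    (hS : ∀ e : S ⟶ S, ∃ c : ℂ, e = c • 𝟙 S) (f : X ⟶ S) (g : X' ⟶ S') :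
    η_ X X' ≫ (f ⊗ₘ g) = (copairing f g : ℂ) • η_ S S' := by
  refine Classical.epsilon_spec (p := fun c : ℂ => η_ X X' ≫ (f ⊗ₘ g) = c • η_ S S') ?_
  set x := η_ X X' ≫ (f ⊗ₘ g)
  obtain ⟨e, he⟩ := (tensorRightHomEquiv (𝟙_ C) S S' S).surjective x
  obtain ⟨c, hc⟩ := hS ((λ_ S).inv ≫ e)
  have : e = c • (λ_ S).hom := by
    rw [← cancel_epi (λ_ S).inv, hc]; simp
  refine ⟨c, ?_⟩
  rw [← he, this]
  have h1 : tensorRightHomEquiv (𝟙_ C) S S' S (c • (λ_ S).hom)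
      = c • tensorRightHomEquiv (𝟙_ C) S S' S ((λ_ S).hom) := by
    simp [tensorRightHomEquiv]
  rw [h1]
  congr 1
  simp [tensorRightHomEquiv, unitors_equal]

/-- The defining property of `M'`. -/
lemma hermitian_conjDual {X X' S S' : C} [ExactPairing X X'] [ExactPairing S S'] {J : Type*}
    [Fintype J] (hS : ∀ e : S ⟶ S, ∃ c : ℂ, e = c • 𝟙 S) [Simple S]
    (b : Module.Basis J ℂ (X ⟶ S)) (f : X ⟶ S) (g : X' ⟶ S') :
    hermitian b f (conjDual b g) = copairing f g := by
  classical
  have hη : η_ S S' ≠ 0 := by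
    intro h0
    apply id_nonzero S
    have h1 := ExactPairing.evaluation_coevaluation S S'
    rw [h0] at h1
    have h2 : (λ_ S).hom ≫ (ρ_ S).inv = 0 := by rw [← h1]; simp
    have h3 : (λ_ S).hom = 0 := by
      rw [← cancel_mono (ρ_ S).inv, h2]; simp
    rw [← cancel_epi (λ_ S).hom, h3]; simp
  have key : (∑ j, b.repr f j * copairing (b j) g) • η_ S S' = (copairing f g : ℂ) • η_ S S' := by
    have hf : f = ∑ j, b.repr f j • b j := (b.sum_repr f).symm
    rw [← copairing_spec hS f g, Finset.sum_smul]
    simp only [mul_smul, ← copairing_spec hS]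
    generalize b.repr f = c at hf
    subst hf
    simp [MonoidalCategory.tensorHom_def, Preadditive.comp_sum, Preadditive.sum_comp,
      sum_whiskerRight]
  have key' := smul_left_injective ℂ hη key
  rw [← key']
  unfold hermitian conjDual
  refine Finset.sum_congr rfl fun j _ => ?_
  simp [map_sum, Finsupp.single_apply]

end Spec

variable [RightRigidCategory C]

/-- `𝓑`-rigid invariance of the split subobject `(A, i, p)` of `X`, where `A' = A*`, `X' = X*`:
for every representative `S` of the simple objects, the map `M'` carries
`Hom(A*, S*) ∘ i*` onto `Hom(A, S) ∘ p`. (The right duals of Mathlib, with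
`ev : S* ⊗ S → 𝟙` and `coev : 𝟙 → S ⊗ S*`, are often called left duals.) -/
def IsRigidInvariant {R : SimpleReps.{w} C} {X : C} (𝓑 : ObjectBasis.{w'} R X)
    (X' : C) [ExactPairing X X'] {A : C} (A' : C) [ExactPairing A A']
    (i : A ⟶ X) (p : X ⟶ A) : Prop :=
  ∀ s : R.idx,
    (fun g : X' ⟶ (R.obj s)ᘁ => conjDual (𝓑.basis s) g) ''
        {g | ∃ t : A' ⟶ (R.obj s)ᘁ, g = (dualMap i : X' ⟶ A') ≫ t} =
      {f : X ⟶ R.obj s | ∃ t : A ⟶ R.obj s, f = p ≫ t}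

/-- A Frobenius subalgebra is `𝓑`-rigid invariant if the split subobject `(A, i, i*)` is, with
respect to the dualities `A* = A` and `X* = X`. -/
def FrobeniusSubalgebra.RigidInvariant {R : SimpleReps.{w} C} {X : C} [FrobeniusAlgebra X]
    (A : FrobeniusSubalgebra X) (𝓑 : ObjectBasis.{w'} R X) : Prop :=
  IsRigidInvariant 𝓑 X A.obj A.incl (dualHom A.incl)

lemma FrobeniusSubalgebra.Equivalent.rigidInvariant_iff {R : SimpleReps.{w} C} {X : C}
    [FrobeniusAlgebra X] {A B : FrobeniusSubalgebra X} (h : A.Equivalent B)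
    (𝓑 : ObjectBasis.{w'} R X) : A.RigidInvariant 𝓑 ↔ B.RigidInvariant 𝓑 := by
  have key : ∀ S : C, {f : X ⟶ S | ∃ t : A.obj ⟶ S, f = dualHom A.incl ≫ t} =
      {f : X ⟶ S | ∃ t : B.obj ⟶ S, f = dualHom B.incl ≫ t} := fun S =>
    Set.ext fun f => ⟨h.contained.factors f, h.contained'.factors f⟩
  unfold FrobeniusSubalgebra.RigidInvariant IsRigidInvariant
  refine forall_congr' fun s => ?_
  have h1 := key (R.obj s)
  have h2 := key (R.obj s)ᘁ
  simp only [dualHom] at h1 h2 ⊢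
  rw [h1, h2]

/-- `𝓑`-rigid invariance of an equivalence class of Frobenius subalgebras. -/
def FrobeniusSubalgebraPoset.RigidInvariant {R : SimpleReps.{w} C} {X : C} [FrobeniusAlgebra X]
    (𝓑 : ObjectBasis.{w'} R X) : FrobeniusSubalgebraPoset X → Prop :=
  Quotient.lift (fun A => A.RigidInvariant 𝓑) fun _ _ h => propext (h.rigidInvariant_iff 𝓑)

/-- The Frobenius `𝓑`-subalgebra poset of `X`: the subposet of the `𝓑`-rigid invariant
elements of the Frobenius subalgebra poset. -/
abbrev FrobeniusBSubalgebraPoset {R : SimpleReps.{w} C} {X : C} [FrobeniusAlgebra X]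
    (𝓑 : ObjectBasis.{w'} R X) : Type max u v :=
  {a : FrobeniusSubalgebraPoset X // FrobeniusSubalgebraPoset.RigidInvariant 𝓑 a}

/-- The class of a `𝓑`-rigid invariant Frobenius subalgebra in the Frobenius `𝓑`-subalgebra
poset. -/
def FrobeniusSubalgebra.toBPoset {R : SimpleReps.{w} C} {X : C} [FrobeniusAlgebra X]
    {𝓑 : ObjectBasis.{w'} R X} (A : FrobeniusSubalgebra X) (hA : A.RigidInvariant 𝓑) :
    FrobeniusBSubalgebraPoset 𝓑 :=
  ⟨A.toPoset, hA⟩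

end Linear

/-- An object that is semisimple of finite length: a finite direct sum of simple objects. -/
def IsSemisimpleOfFiniteLength {C : Type u} [Category.{v} C] [Limits.HasZeroMorphisms C]
    (X : C) : Prop :=
  ∃ (n : ℕ) (S : Fin n → C) (b : Limits.Bicone S),
    (∀ k, Simple (S k)) ∧ Nonempty b.IsBilimit ∧ Nonempty (b.pt ≅ X)

/-- A partially ordered set is a lattice if every pair of elements has an infimum and a
supremum. -/
def IsLatticeOrder (P : Type*) [PartialOrder P] : Prop :=
  (∀ a b : P, ∃ c, IsGLB {a, b} c) ∧ ∀ a b : P, ∃ c, IsLUB {a, b} c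

end FrobLattice

end

/-! A Frobenius subalgebra `(A, i)` is encoded by the idempotent `proj` of X, the composite of i*
and i, which is its own dual; containment means that one idempotent absorbs the other
(`contained_iff_proj`). Conversely, a subalgebra that is the image of a self-dual idempotent
inherits a Frobenius structure (`frobeniusOfRetraction`).

Since `proj` is its own adjoint for κ', the map M' intertwines its action on Hom(X, S*) with the
Hermitian adjoint of its action on Hom(X, S). Rigid invariance therefore says that `proj` acts on
every Hom(X, S) as an orthogonal projection (`rigidInvariant_iff_actsHermitian`).

For two such idempotents a and b, positivity of the form shows that aba fixes exactly the vectors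
fixed by both. The projection e onto them is a polynomial in aba, hence a self-dual morphism of the
category, and it acts by orthogonal projections (`exists_projection_inf`). It splits the inclusion
of the pullback, so the intersection is a rigid invariant Frobenius subalgebra, and the universal
property makes it the meet.

Joins are formal: End(X) is finite-dimensional, which gives the descending chain condition, and X
itself is the top element (`isLatticeOrder_of_isGLB`). -/

noncomputable section

namespace FrobLattice

open scoped MonObj ComonObj

/-! ### Nondegeneracy of evaluations and characterization of dual morphisms -/

section Monoidal

variable {C : Type u} [Category.{v} C] [MonoidalCategory C]

lemma eq_of_whiskerRight_evaluation {A A' Y : C} [a : ExactPairing A A'] {f g : Y ⟶ A'}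
    (h : f ▷ A ≫ ε_ A A' = g ▷ A ≫ ε_ A A') : f = g := by
  let _ : HasRightDual A := ⟨A'⟩
  have hf := tensorRightHomEquiv_whiskerRight_comp_evaluation (X := A) f
  have hg := tensorRightHomEquiv_whiskerRight_comp_evaluation (X := A) g
  have h' : f ▷ A ≫ ε_ A Aᘁ = g ▷ A ≫ ε_ A Aᘁ := h
  rw [h', hg, cancel_mono] at hf
  exact hf.symm

lemma eq_of_whiskerLeft_evaluation {A A' Y : C} [a : ExactPairing A A'] {f g : Y ⟶ A}
    (h : A' ◁ f ≫ ε_ A A' = A' ◁ g ≫ ε_ A A') : f = g := by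
  let _ : HasLeftDual A' := ⟨A⟩
  have hf := tensorLeftHomEquiv_whiskerLeft_comp_evaluation (Z := A') f
  have hg := tensorLeftHomEquiv_whiskerLeft_comp_evaluation (Z := A') g
  have h' : A' ◁ f ≫ ε_ (ᘁA') A' = A' ◁ g ≫ ε_ (ᘁA') A' := h
  rw [h', hg, cancel_mono] at hf
  exact hf.symm

lemma dualMap_comp_evaluation {A A' X X' : C} [a : ExactPairing A A'] [x : ExactPairing X X']
    (f : A ⟶ X) : (dualMap f : X' ⟶ A') ▷ A ≫ ε_ A A' = X' ◁ f ≫ ε_ X X' := by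
  let _ : HasRightDual A := ⟨A'⟩
  let _ : HasRightDual X := ⟨X'⟩
  exact rightAdjointMate_comp_evaluation f

lemma coevaluation_comp_dualMap {A A' X X' : C} [a : ExactPairing A A'] [x : ExactPairing X X']
    (f : A ⟶ X) : η_ X X' ≫ X ◁ (dualMap f : X' ⟶ A') = η_ A A' ≫ f ▷ A' := by
  let _ : HasRightDual A := ⟨A'⟩
  let _ : HasRightDual X := ⟨X'⟩
  exact coevaluation_comp_rightAdjointMate f

/-- Duals are adjoints for the evaluation pairings. In particular an endomorphism of a Frobenius
algebra is self-dual iff it is self-adjoint for ε ∘ m, which is the form of the hypothesis `hb`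
below. -/
lemma dualMap_eq_iff {A A' X X' : C} [a : ExactPairing A A'] [x : ExactPairing X X']
    (f : A ⟶ X) (g : X' ⟶ A') :
    dualMap f = g ↔ X' ◁ f ≫ ε_ X X' = g ▷ A ≫ ε_ A A' := by
  have e : (dualMap f : X' ⟶ A') ▷ A ≫ ε_ A A' = X' ◁ f ≫ ε_ X X' := dualMap_comp_evaluation f
  rw [← e]
  exact ⟨fun h => by rw [h], eq_of_whiskerRight_evaluation⟩

/-! ### Frobenius structures on retracts -/

section Frobenius

variable {X : C} [FrobeniusAlgebra X]

lemma evaluation_eq : ε_ X X = μ[X] ≫ ε[X] := rfl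

lemma coevaluation_eq : η_ X X = η[X] ≫ Δ[X] := rfl

/-- The Frobenius relation applied to x ⊗ 1: Δ(x) is x times the first leg of the coevaluation. -/
lemma comul_eq : Δ[X] = (ρ_ X).inv ≫ X ◁ (η[X] ≫ Δ[X]) ≫ (α_ X X X).inv ≫ μ[X] ▷ X := by
  have h := FrobeniusAlgebra.frobenius_right (X := X)
  rw [whiskerLeft_comp_assoc, h]
  simp

variable {D : C} [MonObj D] {i : D ⟶ X} [IsMonHom i] {p : X ⟶ D}

/-- Like a conditional expectation, p is right D-linear. With E = ip and ⟨x, y⟩ = ε(xy), both sides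
have the same pairing with every y: ⟨E(xd), y⟩ = ⟨xd, Ey⟩ = ⟨x, d·Ey⟩, and ⟨Ex·d, y⟩ = ⟨Ex·d, Ey⟩ =
⟨x, E(d·Ey)⟩ = ⟨x, d·Ey⟩, since E fixes D. -/
lemma retraction_whiskerLeft_mul (hip : i ≫ p = 𝟙 D)
    (hb : X ◁ (p ≫ i) ≫ μ[X] ≫ ε[X] = (p ≫ i) ▷ X ≫ μ[X] ≫ ε[X]) :
    X ◁ i ≫ μ[X] ≫ p = p ▷ D ≫ μ[D] := by
  have hi : Mono i := mono_of_mono_fac hip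
  rw [← cancel_mono i]
  apply eq_of_whiskerRight_evaluation (A := X)
  rw [evaluation_eq]
  have hb' : ∀ {Y : C} (f : Y ⟶ X), (f ≫ p ≫ i) ▷ X ≫ μ[X] ≫ ε[X] =
      f ▷ X ≫ X ◁ (p ≫ i) ≫ μ[X] ≫ ε[X] := by
    intro Y f
    rw [hb, comp_whiskerRight_assoc]
  have hm : D ◁ p ≫ μ[D] ≫ i = i ▷ X ≫ X ◁ (p ≫ i) ≫ μ[X] := by
    rw [IsMonHom.mul_hom, MonoidalCategory.tensorHom_def]
    simp [whisker_exchange_assoc]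
  have e1 : ((X ◁ i ≫ μ[X] ≫ p) ≫ i) ▷ X ≫ μ[X] ≫ ε[X] =
      (α_ X D X).hom ≫ X ◁ (D ◁ p ≫ μ[D] ≫ i) ≫ μ[X] ≫ ε[X] := by
    rw [hm]
    simp only [Category.assoc]
    rw [← Category.assoc (X ◁ i), hb']
    simp only [comp_whiskerRight, Category.assoc]
    rw [← whisker_exchange_assoc]
    rw [MonObj.mul_assoc_assoc]
    simp
  have e2 : ((p ▷ D ≫ μ[D]) ≫ i) ▷ X ≫ μ[X] ≫ ε[X] =
      (α_ X D X).hom ≫ (p ≫ i) ▷ (D ⊗ X) ≫ X ◁ (D ◁ p ≫ μ[D] ≫ i) ≫ μ[X] ≫ ε[X] := by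
    have : (p ▷ D ≫ μ[D]) ≫ i = ((p ≫ i) ▷ D ≫ X ◁ i ≫ μ[X]) ≫ p ≫ i := by
      have : ((p ≫ i) ▷ D ≫ X ◁ i ≫ μ[X]) = p ▷ D ≫ μ[D] ≫ i := by
        rw [IsMonHom.mul_hom, MonoidalCategory.tensorHom_def]
        simp
      rw [this]
      simp only [Category.assoc]
      rw [reassoc_of% hip]
    rw [this, hb', hm]
    simp only [comp_whiskerRight, Category.assoc]
    rw [← whisker_exchange_assoc]
    rw [MonObj.mul_assoc_assoc]
    simp
  rw [e1, e2]
  rw [← whisker_exchange_assoc, ← hb, ← MonoidalCategory.whiskerLeft_comp_assoc]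
  simp only [Category.assoc]
  rw [reassoc_of% hip]

lemma retraction_whiskerRight_mul (hip : i ≫ p = 𝟙 D)
    (hb : X ◁ (p ≫ i) ≫ μ[X] ≫ ε[X] = (p ≫ i) ▷ X ≫ μ[X] ≫ ε[X]) :
    i ▷ X ≫ μ[X] ≫ p = D ◁ p ≫ μ[D] := by
  have hi : Mono i := mono_of_mono_fac hip
  rw [← cancel_mono i]
  apply eq_of_whiskerLeft_evaluation (A' := X)
  rw [evaluation_eq]
  have hb' : ∀ {Y : C} (f : Y ⟶ X), X ◁ (f ≫ p ≫ i) ≫ μ[X] ≫ ε[X] =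
      X ◁ f ≫ (p ≫ i) ▷ X ≫ μ[X] ≫ ε[X] := by
    intro Y f
    rw [← hb, MonoidalCategory.whiskerLeft_comp_assoc]
  have hm : p ▷ D ≫ μ[D] ≫ i = X ◁ i ≫ (p ≫ i) ▷ X ≫ μ[X] := by
    rw [IsMonHom.mul_hom, MonoidalCategory.tensorHom_def]
    simp [whisker_exchange_assoc]
  have e1 : X ◁ ((i ▷ X ≫ μ[X] ≫ p) ≫ i) ≫ μ[X] ≫ ε[X] =
      (α_ X D X).inv ≫ (p ▷ D ≫ μ[D] ≫ i) ▷ X ≫ μ[X] ≫ ε[X] := by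
    rw [hm]
    simp only [Category.assoc]
    rw [← Category.assoc (i ▷ X), hb']
    simp only [comp_whiskerRight, MonoidalCategory.whiskerLeft_comp, Category.assoc]
    rw [MonObj.mul_assoc_assoc]
    simp [whisker_exchange_assoc]
  have e2 : X ◁ ((D ◁ p ≫ μ[D]) ≫ i) ≫ μ[X] ≫ ε[X] =
      (α_ X D X).inv ≫ (X ⊗ D) ◁ (p ≫ i) ≫ (p ▷ D ≫ μ[D] ≫ i) ▷ X ≫ μ[X] ≫ ε[X] := by
    have : (D ◁ p ≫ μ[D]) ≫ i = (D ◁ (p ≫ i) ≫ i ▷ X ≫ μ[X]) ≫ p ≫ i := by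
      have : (D ◁ (p ≫ i) ≫ i ▷ X ≫ μ[X]) = D ◁ p ≫ μ[D] ≫ i := by
        rw [IsMonHom.mul_hom, MonoidalCategory.tensorHom_def]
        simp [whisker_exchange_assoc]
      rw [this]
      simp only [Category.assoc]
      rw [reassoc_of% hip]
    rw [this, hb', hm]
    simp only [comp_whiskerRight, MonoidalCategory.whiskerLeft_comp, Category.assoc]
    rw [MonObj.mul_assoc_assoc]
    simp [whisker_exchange_assoc]
  rw [e1, e2]
  rw [whisker_exchange_assoc, hb, ← MonoidalCategory.comp_whiskerRight_assoc]
  simp only [Category.assoc]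
  rw [reassoc_of% hip]

/-- With E = ip, self-adjointness and E(1) = 1 give ε(Ex) = ε(Ex·1) = ε(x·E1) = ε(x). -/
lemma retraction_counit (hip : i ≫ p = 𝟙 D)
    (hb : X ◁ (p ≫ i) ≫ μ[X] ≫ ε[X] = (p ≫ i) ▷ X ≫ μ[X] ≫ ε[X]) :
    p ≫ i ≫ ε[X] = ε[X] := by
  have h1 : η[X] ≫ p ≫ i = η[X] := by
    rw [← IsMonHom.one_hom i, Category.assoc, reassoc_of% hip]
  have h2 : ε[X] = (ρ_ X).inv ≫ X ◁ η[X] ≫ μ[X] ≫ ε[X] := by simp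
  conv_lhs => rw [h2]
  conv_rhs => rw [h2, ← h1, MonoidalCategory.whiskerLeft_comp_assoc, hb]
  rw [← Category.assoc p i, MonoidalCategory.rightUnitor_inv_naturality_assoc, ← whisker_exchange_assoc]

/-- E = ip may be moved between the legs of the coevaluation Σ u ⊗ v. Hence (p ⊗ p)Δ(x) = Σ p(xu) ⊗
p(v) = Σ p(x·Eu) ⊗ p(v) = Σ p(x)p(u) ⊗ p(v) by D-linearity, which depends on p(x) only. -/
lemma retraction_comul (hip : i ≫ p = 𝟙 D)
    (hb : X ◁ (p ≫ i) ≫ μ[X] ≫ ε[X] = (p ≫ i) ▷ X ≫ μ[X] ≫ ε[X]) :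
    p ≫ i ≫ Δ[X] ≫ (p ⊗ₘ p) = Δ[X] ≫ (p ⊗ₘ p) := by
  have hm := retraction_whiskerLeft_mul hip hb
  have hd : dualHom (p ≫ i) = p ≫ i := (dualMap_eq_iff _ _).2 hb
  have hc : η[X] ≫ Δ[X] ≫ (p ≫ i) ▷ X = η[X] ≫ Δ[X] ≫ X ◁ (p ≫ i) := by
    have : η_ X X ≫ X ◁ dualHom (p ≫ i) = η_ X X ≫ (p ≫ i) ▷ X := coevaluation_comp_dualMap _
    rw [hd, coevaluation_eq] at this
    simpa using this.symm
  have hc' : (η[X] ≫ Δ[X]) ≫ X ◁ p = (η[X] ≫ Δ[X]) ≫ (p ⊗ₘ p) ≫ i ▷ D := by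
    have : (p ⊗ₘ p) ≫ i ▷ D = (p ≫ i) ▷ X ≫ X ◁ p := by
      simp [MonoidalCategory.tensorHom_def, whisker_exchange]
    rw [this]
    simp only [Category.assoc]
    rw [reassoc_of% hc, ← MonoidalCategory.whiskerLeft_comp, Category.assoc, hip, Category.comp_id]
  have key : Δ[X] ≫ (p ⊗ₘ p) = (ρ_ X).inv ≫ X ◁ ((η[X] ≫ Δ[X]) ≫ (p ⊗ₘ p)) ≫
      (α_ X D D).inv ≫ (p ▷ D ≫ μ[D]) ▷ D := by
    conv_lhs => rw [comul_eq]
    calc _ = (ρ_ X).inv ≫ X ◁ ((η[X] ≫ Δ[X]) ≫ X ◁ p) ≫ (α_ X X D).inv ≫ (μ[X] ≫ p) ▷ D := by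
          simp [MonoidalCategory.tensorHom_def', ← whisker_exchange_assoc]
      _ = (ρ_ X).inv ≫ X ◁ ((η[X] ≫ Δ[X]) ≫ (p ⊗ₘ p)) ≫ (α_ X D D).inv ≫
            (X ◁ i ≫ μ[X] ≫ p) ▷ D := by
          rw [hc']
          simp
      _ = _ := by rw [hm]
  rw [key, ← Category.assoc p i, MonoidalCategory.rightUnitor_inv_naturality_assoc,
    ← whisker_exchange_assoc]
  rw [associator_inv_naturality_left_assoc, ← MonoidalCategory.comp_whiskerRight,
    ← MonoidalCategory.comp_whiskerRight_assoc]
  simp only [Category.assoc]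
  rw [hip, Category.comp_id]

/-- The Frobenius algebra structure on a subalgebra of a Frobenius algebra onto which there is a
self-dual projection. -/
abbrev frobeniusOfRetraction (i : D ⟶ X) [IsMonHom i] (p : X ⟶ D) (hip : i ≫ p = 𝟙 D)
    (hb : X ◁ (p ≫ i) ≫ μ[X] ≫ ε[X] = (p ≫ i) ▷ X ≫ μ[X] ≫ ε[X]) : FrobeniusAlgebra D :=
  have hp : Epi p := epi_of_epi_fac hip
  have hε := retraction_counit hip hb
  have hΔ := retraction_comul hip hb
  have hl := retraction_whiskerLeft_mul hip hb
  have hr := retraction_whiskerRight_mul hip hb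
  { ‹MonObj D› with
    counit := i ≫ ε[X]
    comul := i ≫ Δ[X] ≫ (p ⊗ₘ p)
    counit_comul := by
      -- After composition with the epimorphism p, `hΔ` replaces the new comultiplication by that of
      -- X, so the coalgebra axioms descend from X.
      rw [← cancel_epi p]
      simp only [Category.assoc]
      rw [reassoc_of% hΔ, MonoidalCategory.tensorHom_def', Category.assoc,
        ← MonoidalCategory.comp_whiskerRight, hε, whisker_exchange]
      simp
    comul_counit := by
      rw [← cancel_epi p]
      simp only [Category.assoc]
      rw [reassoc_of% hΔ, MonoidalCategory.tensorHom_def, Category.assoc,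
        ← MonoidalCategory.whiskerLeft_comp, hε, ← whisker_exchange]
      simp
    comul_assoc := by
      rw [← cancel_epi p]
      simp only [Category.assoc]
      rw [reassoc_of% hΔ]
      calc Δ[X] ≫ (p ⊗ₘ p) ≫ D ◁ (i ≫ Δ[X] ≫ (p ⊗ₘ p))
          = Δ[X] ≫ (p ⊗ₘ (p ≫ i ≫ Δ[X] ≫ (p ⊗ₘ p))) := by
            simp [MonoidalCategory.tensorHom_def]
        _ = (Δ[X] ≫ X ◁ Δ[X]) ≫ (p ⊗ₘ p ⊗ₘ p) := by
            rw [hΔ, Category.assoc, ← id_tensorHom, tensorHom_comp_tensorHom, Category.id_comp]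
        _ = Δ[X] ≫ ((Δ[X] ≫ (p ⊗ₘ p)) ⊗ₘ p) ≫ (α_ D D D).hom := by
            rw [ComonObj.comul_assoc]
            simp only [Category.assoc, ← associator_naturality]
            rw [← tensorHom_id, tensorHom_comp_tensorHom_assoc, Category.id_comp]
        _ = _ := by
            have : (Δ[X] ≫ (p ⊗ₘ p)) ⊗ₘ p = (p ⊗ₘ p) ≫ (i ≫ Δ[X] ≫ (p ⊗ₘ p)) ▷ D := by
              rw [← tensorHom_id, tensorHom_comp_tensorHom, Category.comp_id, hΔ]
            rw [this, Category.assoc, reassoc_of% hΔ]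
    frobenius_left := by
      calc _ = i ▷ D ≫ Δ[X] ▷ D ≫ (α_ X X D).hom ≫ p ▷ (X ⊗ D) ≫ D ◁ (p ▷ D ≫ μ[D]) := by
            simp [MonoidalCategory.tensorHom_def]
        _ = (i ⊗ₘ i) ≫ (Δ[X] ▷ X ≫ (α_ X X X).hom ≫ X ◁ μ[X]) ≫ (p ⊗ₘ p) := by
            rw [← hl, ← whisker_exchange, MonoidalCategory.tensorHom_def i i,
              MonoidalCategory.tensorHom_def' p p]
            simp [whisker_exchange_assoc]
        _ = _ := by
            rw [FrobeniusAlgebra.frobenius_left, IsMonHom.mul_hom_assoc, Category.assoc]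
    frobenius_right := by
      calc _ = D ◁ i ≫ D ◁ Δ[X] ≫ (α_ D X X).inv ≫ (D ⊗ X) ◁ p ≫ (D ◁ p ≫ μ[D]) ▷ D := by
            simp [MonoidalCategory.tensorHom_def']
        _ = (i ⊗ₘ i) ≫ (X ◁ Δ[X] ≫ (α_ X X X).inv ≫ μ[X] ▷ X) ≫ (p ⊗ₘ p) := by
            rw [← hr, whisker_exchange, MonoidalCategory.tensorHom_def' i i,
              MonoidalCategory.tensorHom_def p p]
            simp [← whisker_exchange_assoc]
        _ = _ := by
            rw [FrobeniusAlgebra.frobenius_right, IsMonHom.mul_hom_assoc, Category.assoc] }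

/-- The pairing of D is the restriction along i of that of X, so self-adjointness of ip makes i and
p dual to each other. -/
lemma isFrobeniusInclusion_of_retraction (i : D ⟶ X) [hi : IsMonHom i] (p : X ⟶ D)
    (hip : i ≫ p = 𝟙 D)
    (hb : X ◁ (p ≫ i) ≫ μ[X] ≫ ε[X] = (p ≫ i) ▷ X ≫ μ[X] ≫ ε[X]) :
    letI := frobeniusOfRetraction i p hip hb
    dualHom i = p ∧ IsFrobeniusInclusion i := by
  let _ := frobeniusOfRetraction i p hip hb
  have he : ε_ D D = (i ⊗ₘ i) ≫ ε_ X X := by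
    change μ[D] ≫ i ≫ ε[X] = (i ⊗ₘ i) ≫ μ[X] ≫ ε[X]
    rw [IsMonHom.mul_hom_assoc]
  rw [← evaluation_eq] at hb
  have h1 : dualHom i = p := by
    refine (dualMap_eq_iff _ _).2 ?_
    rw [he, MonoidalCategory.tensorHom_def, Category.assoc, ← comp_whiskerRight_assoc,
      ← whisker_exchange_assoc, ← hb, ← MonoidalCategory.whiskerLeft_comp_assoc, reassoc_of% hip]
  have h2 : dualHom p = i := by
    refine (dualMap_eq_iff _ _).2 ?_
    rw [he, MonoidalCategory.tensorHom_def', Category.assoc,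
      ← MonoidalCategory.whiskerLeft_comp_assoc, whisker_exchange_assoc, hb,
      ← MonoidalCategory.comp_whiskerRight_assoc, reassoc_of% hip]
  exact ⟨h1, mono_of_mono_fac hip, hi, by rw [h1, h2], by rw [h1, hip]⟩

/-! ### The self-dual idempotent of a Frobenius subalgebra -/

/-- The projection `i* ≫ i` of a Frobenius subalgebra. -/
def FrobeniusSubalgebra.proj (A : FrobeniusSubalgebra X) : X ⟶ X := dualHom A.incl ≫ A.incl

lemma FrobeniusSubalgebra.dualHom_proj (A : FrobeniusSubalgebra X) : dualHom A.proj = A.proj := by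
  have h : dualHom (dualHom A.incl ≫ A.incl) = dualHom A.incl ≫ dualHom (dualHom A.incl) :=
    dualMap_comp _ _
  rw [proj, h, A.isIncl.dual_dual]

lemma FrobeniusSubalgebra.incl_proj (A : FrobeniusSubalgebra X) : A.incl ≫ A.proj = A.incl := by
  rw [proj, ← Category.assoc, A.isIncl.comp_dual, Category.id_comp]

lemma FrobeniusSubalgebra.proj_dualHom (A : FrobeniusSubalgebra X) :
    A.proj ≫ dualHom A.incl = dualHom A.incl := by
  rw [proj, Category.assoc, A.isIncl.comp_dual, Category.comp_id]

lemma FrobeniusSubalgebra.proj_proj (A : FrobeniusSubalgebra X) : A.proj ≫ A.proj = A.proj := by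
  calc A.proj ≫ A.proj = (A.proj ≫ dualHom A.incl) ≫ A.incl := (Category.assoc _ _ _).symm
    _ = A.proj := by rw [proj_dualHom]; rfl

/-- The remaining conditions in containment are automatic: substituting the factorization into i_A*
∘ i_A = id and cancelling i_B* ∘ i_B leaves f* ∘ f = id. -/
lemma FrobeniusSubalgebra.contained_of_fac {A B : FrobeniusSubalgebra X} (f : A.obj ⟶ B.obj)
    (h : A.incl = f ≫ B.incl) : A.Contained B := by
  have := A.isIncl.mono
  refine ⟨f, mono_of_mono_fac h.symm, h, ?_⟩
  have hd : dualHom A.incl = dualHom B.incl ≫ dualHom f := by rw [h]; exact dualMap_comp _ _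
  have h1 := A.isIncl.comp_dual
  rwa [hd, h, Category.assoc, ← Category.assoc B.incl, B.isIncl.comp_dual, Category.id_comp] at h1

lemma FrobeniusSubalgebra.contained_iff_proj {A B : FrobeniusSubalgebra X} :
    A.Contained B ↔ A.proj ≫ B.proj = A.proj := by
  constructor
  · rintro ⟨f, -, hf, -⟩
    rw [proj, Category.assoc, hf, Category.assoc, B.incl_proj]
  · intro h
    have h1 : A.incl ≫ B.proj = A.incl := by
      rw [← A.incl_proj, Category.assoc, h]
    exact contained_of_fac (A.incl ≫ dualHom B.incl) (by rw [Category.assoc]; exact h1.symm)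

/-- The whole Frobenius algebra as a Frobenius subalgebra. -/
def FrobeniusSubalgebra.whole (X : C) [FrobeniusAlgebra X] : FrobeniusSubalgebra X where
  obj := X
  incl := 𝟙 X
  isIncl :=
    { mono := inferInstance
      isMonHom := inferInstance
      dual_dual := by simp [dualHom, dualMap_id]
      comp_dual := by simp [dualHom, dualMap_id] }

end Frobenius

end Monoidal

/-! ### Orthogonal projections in finite-dimensional Hermitian spaces -/

section Hermitian

variable {J V W : Type*} [Fintype J] [AddCommGroup V] [Module ℂ V] [AddCommGroup W] [Module ℂ W]
  (b : Module.Basis J ℂ V)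

lemma hermitian_sub_left (x y z : V) :
    hermitian b (x - y) z = hermitian b x z - hermitian b y z := by
  simp [hermitian, sub_mul, Finset.sum_sub_distrib]

lemma hermitian_sub_right (x y z : V) :
    hermitian b x (y - z) = hermitian b x y - hermitian b x z := by
  simp [hermitian, mul_sub, Finset.sum_sub_distrib]

lemma conj_hermitian (x y : V) :
    (starRingEnd ℂ) (hermitian b x y) = hermitian b y x := by
  simp [hermitian, mul_comm]

lemma eq_zero_of_hermitian_self {x : V} (h : hermitian b x x = 0) : x = 0 := by
  have h' : ∑ j, Complex.normSq (b.repr x j) = 0 := by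
    have : hermitian b x x = ((∑ j, Complex.normSq (b.repr x j) : ℝ) : ℂ) := by
      simp [hermitian, Complex.mul_conj]
    rw [this] at h
    exact_mod_cast h
  rw [Finset.sum_eq_zero_iff_of_nonneg fun j _ => Complex.normSq_nonneg _] at h'
  refine b.ext_elem fun j => ?_
  simpa using h' j (Finset.mem_univ j)

lemma eq_of_hermitian_eq {x y : V} (h : ∀ z, hermitian b z x = hermitian b z y) : x = y := by
  rw [← sub_eq_zero]
  apply eq_zero_of_hermitian_self b
  rw [hermitian_sub_right, h, sub_self]

/-- A linear endomorphism is self-adjoint for the form `hermitian b`. -/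
def IsHermitianFor (P : V →ₗ[ℂ] V) : Prop :=
  ∀ x y, hermitian b (P x) y = hermitian b x (P y)

variable {b}

lemma isHermitianFor_of_orthogonal {P : V →ₗ[ℂ] V}
    (h : ∀ x y, hermitian b (P x) (y - P y) = 0) : IsHermitianFor b P := by
  have h1 : ∀ x y, hermitian b (P x) y = hermitian b (P x) (P y) := fun x y => by
    rw [← sub_eq_zero, ← hermitian_sub_right, h]
  intro x y
  rw [h1, ← conj_hermitian b (P y) x, h1 y x, conj_hermitian]

/-- A vector that is fixed by the product `P Q P` of orthogonal projections is fixed by `Q`. -/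
lemma IsHermitianFor.fixed_of_comp {P Q : V →ₗ[ℂ] V} (hP : IsHermitianFor b P)
    (hQ : IsHermitianFor b Q) (hPP : ∀ x, P (P x) = P x) (hQQ : ∀ x, Q (Q x) = Q x) {x : V}
    (hx : P (Q (P x)) = x) : P x = x ∧ Q x = x := by
  have h1 : P x = x := by rw [← hx, hPP]
  refine ⟨h1, ?_⟩
  -- The equality ⟨x, x⟩ = ⟨Qx, x⟩ = ⟨Qx, Qx⟩ forces x - Qx to have norm zero.
  have h2 : hermitian b x x = hermitian b (Q x) x := by
    calc hermitian b x x = hermitian b (P (Q (P x))) x := by rw [hx]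
      _ = hermitian b (Q x) x := by rw [hP, h1]
  have h3 : hermitian b (Q x) (Q x) = hermitian b (Q x) x := by rw [← hQ, hQQ]
  have h4 : x - Q x = 0 := by
    apply eq_zero_of_hermitian_self b
    rw [hermitian_sub_left, hermitian_sub_right, hermitian_sub_right, ← hQ x x, h3, h2]
    ring
  exact (sub_eq_zero.1 h4).symm

/-- Let `κ` be a pairing that is nondegenerate in the first variable, let `M` be the conjugate
linear map with `⟨f, M g⟩ = κ f g`, and let the idempotents `P` and `Q` be adjoint for `κ`. Then
`M` maps the image of `Q` onto the image of `P` if and only if `P` is an orthogonal projection. -/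
lemma image_fixed_eq_iff (κ : V →ₗ[ℂ] W →ₗ[ℂ] ℂ) (hκ : ∀ f, (∀ g, κ f g = 0) → f = 0)
    (M : W → V) (hM : ∀ f g, hermitian b f (M g) = κ f g) (P : V →ₗ[ℂ] V) (Q : W →ₗ[ℂ] W)
    (hPP : ∀ x, P (P x) = P x) (hQQ : ∀ x, Q (Q x) = Q x) (hPQ : ∀ f g, κ (P f) g = κ f (Q g)) :
    M '' {g | Q g = g} = {f | P f = f} ↔ IsHermitianFor b P := by
  classical
  constructor
  · intro h
    apply isHermitianFor_of_orthogonal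
    intro x y
    -- Writing Px = M(g) with Qg = g gives ⟨y - Py, Px⟩ = κ(y - Py, Qg) = κ(P(y - Py), g) = 0.
    obtain ⟨g, hg, hgx⟩ : P x ∈ M '' {g | Q g = g} := by rw [h]; exact hPP x
    rw [← conj_hermitian, ← hgx, hM, ← show Q g = g from hg, ← hPQ]
    simp [hPP]
  · intro h
    have hMQ : ∀ g, M (Q g) = P (M g) := fun g => by
      apply eq_of_hermitian_eq b
      intro z
      rw [hM, ← hPQ, ← h, hM]
    have : FiniteDimensional ℂ V := b.finiteDimensional_of_finite
    -- As V is finite-dimensional, nondegeneracy in the first variable means that every functional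
    -- on V is κ(·, g) for some g.
    have hsurj : Function.Surjective κ.flip := by
      rw [← LinearMap.flip_injective_iff₂, LinearMap.flip_flip, injective_iff_map_eq_zero]
      exact fun f hf => hκ f fun g => by rw [hf]; rfl
    have hMs : Function.Surjective M := fun x => by
      -- This functional is z ↦ ⟨z, x⟩.
      obtain ⟨g, hg⟩ := hsurj (∑ j, (starRingEnd ℂ) (b.repr x j) • b.coord j)
      refine ⟨g, eq_of_hermitian_eq b fun z => ?_⟩
      rw [hM, ← LinearMap.flip_apply, hg]
      simp [hermitian, mul_comm]
    ext f
    constructor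
    · rintro ⟨g, hg, rfl⟩
      rw [Set.mem_ofPred_eq, ← hMQ, show Q g = g from hg]
    · intro hf
      obtain ⟨g, rfl⟩ := hMs f
      exact ⟨Q g, hQQ g, by rw [hMQ]; exact hf⟩

end Hermitian

/-- Write the minimal polynomial as (X - 1)^k r with r(1) ≠ 0. The hypothesis lowers the power of T
- 1 annihilated by r(T) to one, and q is r normalized at 1. -/
lemma exists_aeval_mul_sub_one_eq_zero {E : Type*} [Ring E] [Algebra ℂ E] [FiniteDimensional ℂ E]
    (T : E) (hT : ∀ y, y * (T - 1) * (T - 1) = 0 → y * (T - 1) = 0) :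
    ∃ q : Polynomial ℂ, q.eval 1 = 1 ∧ Polynomial.aeval T q * (T - 1) = 0 := by
  have hpow : ∀ (k : ℕ) (y : E), y * (T - 1) ^ k = 0 → y * (T - 1) = 0 := by
    intro k
    induction k with
    | zero => intro y hy; rw [pow_zero, mul_one] at hy; rw [hy, zero_mul]
    | succ k ih =>
      intro y hy
      rw [pow_succ', ← mul_assoc] at hy
      exact hT y (ih _ hy)
  have hm : minpoly ℂ T ≠ 0 := minpoly.ne_zero (Algebra.IsIntegral.isIntegral T)
  obtain ⟨r, hr, hdvd⟩ :=
    Polynomial.exists_eq_pow_rootMultiplicity_mul_and_not_dvd (minpoly ℂ T) hm 1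
  have hr1 : r.eval 1 ≠ 0 := fun h => hdvd (Polynomial.dvd_iff_isRoot.2 h)
  refine ⟨Polynomial.C (r.eval 1)⁻¹ * r, by simp [hr1], ?_⟩
  have h0 := minpoly.aeval ℂ T
  rw [hr, mul_comm] at h0
  have h1 : Polynomial.aeval T r * (T - 1) = 0 := hpow _ _ (by simpa using h0)
  rw [map_mul, mul_assoc, h1, mul_zero]

/-! ### Consequences of semisimplicity -/

section Semisimple

variable {C : Type u} [Category.{v} C] [Abelian C]

lemma exists_section_of_semisimple {X S : C} (hX : IsSemisimpleOfFiniteLength X) [Simple S]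
    {f : X ⟶ S} (hf : f ≠ 0) : ∃ h : S ⟶ X, h ≫ f = 𝟙 S := by
  obtain ⟨n, T, c, hT, ⟨hc⟩, ⟨e⟩⟩ := hX
  obtain ⟨k, hk⟩ : ∃ k, c.ι k ≫ e.hom ≫ f ≠ 0 := by
    by_contra! h
    apply hf
    rw [← cancel_epi e.hom, Limits.comp_zero]
    refine hc.isColimit.hom_ext fun ⟨k⟩ => ?_
    exact (h k).trans Limits.comp_zero.symm
  have := hT k
  have := isIso_of_hom_simple hk
  exact ⟨inv (c.ι k ≫ e.hom ≫ f) ≫ c.ι k ≫ e.hom, by simp⟩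

/-- Each simple summand of X is isomorphic to a representative. This transfers identities from the
Hermitian spaces Hom(X, S) to endomorphisms of X. -/
lemma hom_ext_of_semisimple (R : SimpleReps.{w} C) {X Y : C}
    (hX : IsSemisimpleOfFiniteLength X) {f g : Y ⟶ X}
    (h : ∀ s (t : X ⟶ R.obj s), f ≫ t = g ≫ t) : f = g := by
  obtain ⟨n, T, c, hT, ⟨hc⟩, ⟨e⟩⟩ := hX
  rw [← cancel_mono e.inv]
  refine hc.isLimit.hom_ext fun ⟨k⟩ => ?_
  obtain ⟨s, ⟨i⟩⟩ := R.exists_iso (T k) (hT k)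
  have := h s (e.inv ≫ c.π k ≫ i.hom)
  rw [← cancel_mono i.hom]
  simpa using this

variable [Linear ℂ C]

lemma finiteDimensional_end_of_semisimple {R : SimpleReps.{w} C} {X : C}
    (hX : IsSemisimpleOfFiniteLength X) (𝓑 : ObjectBasis.{w'} R X) :
    FiniteDimensional ℂ (X ⟶ X) := by
  obtain ⟨n, T, c, hT, ⟨hc⟩, ⟨e⟩⟩ := hX
  choose s i using fun k => R.exists_iso (T k) (hT k)
  have : ∀ k, FiniteDimensional ℂ (X ⟶ R.obj (s k)) := fun k =>
    (𝓑.basis (s k)).finiteDimensional_of_finite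
  let φ : (X ⟶ X) →ₗ[ℂ] (∀ k, X ⟶ R.obj (s k)) :=
    LinearMap.pi fun k => Linear.rightComp ℂ X (e.inv ≫ c.π k ≫ (i k).some.hom)
  refine FiniteDimensional.of_injective φ ?_
  intro f g h
  rw [← cancel_mono e.inv]
  refine hc.isLimit.hom_ext fun ⟨k⟩ => ?_
  have := congrFun h k
  rw [← cancel_mono (i k).some.hom]
  simpa [φ] using this

end Semisimple

/-! ### The pairing κ' and rigid invariance as self-adjointness -/

section Preadditive

variable {C : Type u} [Category.{v} C] [Preadditive C] [MonoidalCategory C] [MonoidalPreadditive C]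

lemma coevaluation_ne_zero {S S' : C} [ExactPairing S S'] [Simple S] : η_ S S' ≠ 0 := by
  intro h0
  apply id_nonzero S
  have h1 := ExactPairing.evaluation_coevaluation S S'
  rw [h0] at h1
  have h2 : (λ_ S).hom ≫ (ρ_ S).inv = 0 := by rw [← h1]; simp
  have h3 : (λ_ S).hom = 0 := by
    rw [← cancel_mono (ρ_ S).inv, h2]; simp
  rw [← cancel_epi (λ_ S).hom, h3]; simp

end Preadditive

section Linear

variable {C : Type u} [Category.{v} C] [Abelian C] [Linear ℂ C] [MonoidalCategory C]
  [MonoidalPreadditive C] [MonoidalLinear ℂ C]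

lemma copairing_eq_of_eq {X X' S S' : C} [ExactPairing X X'] [ExactPairing S S'] [Simple S]
    (hS : ∀ e : S ⟶ S, ∃ c : ℂ, e = c • 𝟙 S) {f : X ⟶ S} {g : X' ⟶ S'} {c : ℂ}
    (h : η_ X X' ≫ (f ⊗ₘ g) = c • η_ S S') : copairing f g = c := by
  rw [copairing_spec hS] at h
  exact smul_left_injective ℂ coevaluation_ne_zero h

/-- The pairing `κ'` as a bilinear map. -/
def copairingBilin {X X' S S' : C} [ExactPairing X X'] [ExactPairing S S'] [Simple S]
    (hS : ∀ e : S ⟶ S, ∃ c : ℂ, e = c • 𝟙 S) : (X ⟶ S) →ₗ[ℂ] (X' ⟶ S') →ₗ[ℂ] ℂ :=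
  LinearMap.mk₂ ℂ copairing
    (fun f f' g => copairing_eq_of_eq hS (by
      rw [add_smul, ← copairing_spec hS, ← copairing_spec hS]
      simp [MonoidalCategory.tensorHom_def]))
    (fun c f g => copairing_eq_of_eq hS (by
      rw [smul_eq_mul, mul_smul, ← copairing_spec hS]
      simp [MonoidalCategory.tensorHom_def]))
    (fun f g g' => copairing_eq_of_eq hS (by
      rw [add_smul, ← copairing_spec hS, ← copairing_spec hS]
      simp [MonoidalCategory.tensorHom_def]))
    (fun c f g => copairing_eq_of_eq hS (by
      rw [smul_eq_mul, mul_smul, ← copairing_spec hS]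
      simp [MonoidalCategory.tensorHom_def]))

/-- Nondegeneracy of κ' in its first variable: a nonzero f from a semisimple X has a section h, and
h* pairs nontrivially with f. -/
lemma copairing_comp_dualMap {X X' S S' : C} [ExactPairing X X'] [ExactPairing S S'] [Simple S]
    (hS : ∀ e : S ⟶ S, ∃ c : ℂ, e = c • 𝟙 S) {f : X ⟶ S} {h : S ⟶ X} (hf : h ≫ f = 𝟙 S) :
    copairing f (dualMap h : X' ⟶ S') = 1 := by
  apply copairing_eq_of_eq hS
  have e : η_ X X' ≫ X ◁ (dualMap h : X' ⟶ S') = η_ S S' ≫ h ▷ S' := coevaluation_comp_dualMap h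
  rw [MonoidalCategory.tensorHom_def', ← Category.assoc, e, Category.assoc,
    ← MonoidalCategory.comp_whiskerRight, hf]
  simp

lemma copairing_comp_left {X S S' : C} [FrobeniusAlgebra X] [ExactPairing S S'] [Simple S]
    (hS : ∀ e : S ⟶ S, ∃ c : ℂ, e = c • 𝟙 S) (u : X ⟶ X) (f : X ⟶ S) (g : X ⟶ S') :
    copairing (u ≫ f) g = copairing f (dualHom u ≫ g) := by
  apply copairing_eq_of_eq hS
  rw [← copairing_spec hS]
  have e : η_ X X ≫ X ◁ dualHom u = η_ X X ≫ u ▷ X := coevaluation_comp_dualMap u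
  have e1 : f ⊗ₘ (dualHom u ≫ g) = X ◁ dualHom u ≫ (f ⊗ₘ g) := by
    rw [← id_tensorHom, tensorHom_comp_tensorHom, Category.id_comp]
  have e2 : (u ≫ f) ⊗ₘ g = u ▷ X ≫ (f ⊗ₘ g) := by
    rw [← tensorHom_id, tensorHom_comp_tensorHom, Category.id_comp]
  rw [e1, e2, reassoc_of% e]

/-- The endomorphism `u` acts on `Hom(X, S)` as a self-adjoint operator, for each `S`. -/
def ActsHermitian {R : SimpleReps.{w} C} {X : C} (𝓑 : ObjectBasis.{w'} R X) (u : X ⟶ X) : Prop :=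
  ∀ s, IsHermitianFor (𝓑.basis s) (Linear.leftComp ℂ (R.obj s) u)

/-- Morphisms factoring through i* are those fixed by precomposition with `proj`, on both sides of
M'. As `proj` is self-dual, these two actions are adjoint for κ', and `image_fixed_eq_iff` applies.
-/
lemma FrobeniusSubalgebra.rigidInvariant_iff_actsHermitian [RightRigidCategory C]
    {R : SimpleReps.{w} C} {X : C} [FrobeniusAlgebra X] (hX : IsSemisimpleOfFiniteLength X)
    (hSchur : ∀ S : C, Simple S → (∃ f : X ⟶ S, f ≠ 0) → ∀ e : S ⟶ S, ∃ c : ℂ, e = c • 𝟙 S)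
    (𝓑 : ObjectBasis.{w'} R X) (A : FrobeniusSubalgebra X) :
    A.RigidInvariant 𝓑 ↔ ActsHermitian 𝓑 A.proj := by
  refine forall_congr' fun s => ?_
  have := R.simple s
  have hfix : ∀ S : C, {f : X ⟶ S | ∃ t : A.obj ⟶ S, f = dualHom A.incl ≫ t} =
      {f | A.proj ≫ f = f} := fun S => by
    ext f
    constructor
    · rintro ⟨t, rfl⟩
      rw [Set.mem_ofPred_eq, ← Category.assoc, A.proj_dualHom]
    · intro h
      exact ⟨A.incl ≫ f, by rw [← Category.assoc]; exact h.symm⟩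
  have h1 := hfix (R.obj s)
  have h2 := hfix (R.obj s)ᘁ
  have hpp : ∀ {S : C} (f : X ⟶ S), A.proj ≫ A.proj ≫ f = A.proj ≫ f := fun f => by
    rw [← Category.assoc, A.proj_proj]
  simp only [dualHom] at h1 h2 ⊢
  rw [h1, h2]
  by_cases h0 : ∃ f : X ⟶ R.obj s, f ≠ 0
  · have hS := hSchur _ (R.simple s) h0
    refine image_fixed_eq_iff (copairingBilin hS) (fun f hf => ?_) _
      (fun f g => hermitian_conjDual hS _ f g) (Linear.leftComp ℂ (R.obj s) A.proj)
      (Linear.leftComp ℂ (R.obj s)ᘁ A.proj) (fun f => hpp f) (fun f => hpp f) fun f g => ?_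
    · by_contra hf0
      obtain ⟨h, hh⟩ := exists_section_of_semisimple hX hf0
      exact one_ne_zero ((copairing_comp_dualMap hS hh).symm.trans (hf (dualMap h)))
    · refine (copairing_comp_left hS A.proj f g).trans ?_
      rw [A.dualHom_proj]
      rfl
  -- Schur's lemma is not assumed for this S, but Hom(X, S) = 0 and both conditions hold trivially.
  · push Not at h0
    refine iff_of_true ?_ fun x y => by simp [h0 x, h0 y]
    ext f
    refine ⟨fun _ => by rw [Set.mem_ofPred_eq, h0 f, Limits.comp_zero],
      fun _ => ⟨0, by simp, by rw [h0 f]; exact h0 _⟩⟩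

/-- Duality is linear and reverses products, which does not affect powers of a single T. -/
lemma dualHom_aeval {X : C} [FrobeniusAlgebra X] {T : X ⟶ X} (hT : dualHom T = T)
    (q : Polynomial ℂ) :
    dualHom (Polynomial.aeval (End.of T) q : End X) = (Polynomial.aeval (End.of T) q : End X) := by
  have hadd : ∀ u v : X ⟶ X, dualHom (u + v) = dualHom u + dualHom v := fun u v => by
    simp [dualHom, dualMap]
  have hsmul : ∀ (c : ℂ) (u : X ⟶ X), dualHom (c • u) = c • dualHom u := fun c u => by
    simp [dualHom, dualMap]
  have hpow : ∀ n : ℕ, dualHom (End.of T ^ n : End X) = (End.of T ^ n : End X) := by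
    intro n
    induction n with
    | zero => exact dualMap_id
    | succ n ih =>
      have h1 : dualHom (T ≫ (End.of T ^ n : End X)) =
          dualHom (End.of T ^ n : End X) ≫ dualHom T := dualMap_comp _ _
      rw [ih, hT] at h1
      have h2 : (End.of T ^ (n + 1) : End X) = T ≫ (End.of T ^ n : End X) := pow_succ _ _
      have h3 : (End.of T ^ (n + 1) : End X) = (End.of T ^ n : End X) ≫ T := pow_succ' _ _
      rw [h2, h1, ← h3, h2]
  induction q using Polynomial.induction_on' with
  | add p q hp hq =>
    rw [map_add]
    exact (hadd _ _).trans (by rw [hp, hq])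
  | monomial n c =>
    have : (Polynomial.aeval (End.of T) (Polynomial.monomial n c) : End X) =
        c • (End.of T ^ n : End X) := by
      rw [Polynomial.aeval_monomial, Algebra.smul_def]
    rw [this]
    exact (hsmul _ _).trans (congrArg (c • ·) (hpow n))

/-- The projection onto the intersection of the images of two orthogonal self-dual projections. -/
lemma exists_projection_inf {R : SimpleReps.{w} C} {X : C} [FrobeniusAlgebra X]
    (hX : IsSemisimpleOfFiniteLength X) (𝓑 : ObjectBasis.{w'} R X) {a b : X ⟶ X}
    (haa : a ≫ a = a) (hbb : b ≫ b = b) (ha : dualHom a = a) (hb : dualHom b = b)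
    (ha' : ActsHermitian 𝓑 a) (hb' : ActsHermitian 𝓑 b) :
    ∃ e : X ⟶ X, e ≫ a = e ∧ e ≫ b = e ∧ dualHom e = e ∧ ActsHermitian 𝓑 e ∧
      ∀ {Y : C} (f : Y ⟶ X), f ≫ a = f → f ≫ b = f → f ≫ e = f := by
  have hfin : FiniteDimensional ℂ (End X) := finiteDimensional_end_of_semisimple hX 𝓑
  -- The palindromic product, unlike ab, is again self-dual and self-adjoint.
  let T : X ⟶ X := a ≫ b ≫ a
  let N : X ⟶ X := T - 𝟙 X
  have hT : dualHom T = T := by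
    have h1 : dualHom (a ≫ b ≫ a) = dualHom (b ≫ a) ≫ dualHom a := dualMap_comp _ _
    have h2 : dualHom (b ≫ a) = dualHom a ≫ dualHom b := dualMap_comp _ _
    rw [h1, h2, ha, hb, Category.assoc]
  have hTh : ∀ (s) (x y : X ⟶ R.obj s),
      hermitian (𝓑.basis s) (T ≫ x) y = hermitian (𝓑.basis s) x (T ≫ y) := fun s x y => by
    have hA : ∀ x y : X ⟶ R.obj s,
      hermitian (𝓑.basis s) (a ≫ x) y = hermitian (𝓑.basis s) x (a ≫ y) := ha' s
    have hB : ∀ x y : X ⟶ R.obj s,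
      hermitian (𝓑.basis s) (b ≫ x) y = hermitian (𝓑.basis s) x (b ≫ y) := hb' s
    simp only [T, Category.assoc]
    rw [hA, hB, hA]
  have hTh1 : ∀ (s) (x y : X ⟶ R.obj s), hermitian (𝓑.basis s) (N ≫ x) y =
      hermitian (𝓑.basis s) x (N ≫ y) := fun s x y => by
    have : ∀ z : X ⟶ R.obj s, N ≫ z = T ≫ z - z := fun z => by
      simp only [N]
      rw [Preadditive.sub_comp, Category.id_comp]
    rw [this, this, hermitian_sub_left, hermitian_sub_right, hTh]
  -- For self-adjoint N, N²v = 0 gives ⟨Nv, Nv⟩ = ⟨v, N²v⟩ = 0, hence Nv = 0.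
  obtain ⟨q, hq1, hq⟩ := exists_aeval_mul_sub_one_eq_zero (End.of T) (by
    intro (y : X ⟶ X) hy
    change N ≫ y = (0 : X ⟶ X)
    refine hom_ext_of_semisimple R hX fun s t => ?_
    rw [Limits.zero_comp, Category.assoc]
    apply eq_zero_of_hermitian_self (𝓑.basis s)
    have hy' : N ≫ N ≫ y = (0 : X ⟶ X) := hy
    rw [hTh1, reassoc_of% hy', Limits.zero_comp]
    simp [hermitian])
  obtain ⟨r, hr⟩ : (Polynomial.X - Polynomial.C (1 : ℂ)) ∣ 1 - q :=
    Polynomial.dvd_iff_isRoot.2 (by simp [hq1])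
  let e : X ⟶ X := (Polynomial.aeval (End.of T) q : End X)
  let d : X ⟶ X := (Polynomial.aeval (End.of T) r : End X)
  have hde : 𝟙 X - e = N ≫ d := by
    have := congrArg (Polynomial.aeval (End.of T)) hr
    rw [mul_comm, map_sub, map_one, map_mul, map_sub, Polynomial.aeval_X, Polynomial.aeval_C,
      map_one] at this
    exact this
  have hTe1 : N ≫ e = 0 := hq
  have hTe : T ≫ e = e := by
    rw [Preadditive.sub_comp, Category.id_comp] at hTe1
    exact sub_eq_zero.1 hTe1
  have hed0 : dualHom e = e := dualHom_aeval hT q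
  have hfix : a ≫ e = e ∧ b ≫ e = e := by
    have : ∀ (s) (t : X ⟶ R.obj s), a ≫ e ≫ t = e ≫ t ∧ b ≫ e ≫ t = e ≫ t := fun s t => by
      refine IsHermitianFor.fixed_of_comp (ha' s) (hb' s) (fun x => ?_) (fun x => ?_)
        (x := e ≫ t) ?_
      · exact (Category.assoc _ _ _).symm.trans (by rw [haa]; rfl)
      · exact (Category.assoc _ _ _).symm.trans (by rw [hbb]; rfl)
      · have : T ≫ e ≫ t = e ≫ t := by rw [← Category.assoc, hTe]
        simpa [T] using this
    exact ⟨hom_ext_of_semisimple R hX fun s t => by rw [Category.assoc, (this s t).1],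
      hom_ext_of_semisimple R hX fun s t => by rw [Category.assoc, (this s t).2]⟩
  -- Positivity only controls precomposition; self-duality moves the absorbed factor to the other
  -- side.
  have hdual : ∀ u : X ⟶ X, dualHom u = u → u ≫ e = e → e ≫ u = e := fun u hu h => by
    have h1 : dualHom (u ≫ e) = dualHom e ≫ dualHom u := dualMap_comp _ _
    rw [h, hu, hed0] at h1
    exact h1.symm
  refine ⟨e, hdual a ha hfix.1, hdual b hb hfix.2, hed0, fun s => ?_, fun {Y} f hfa hfb => ?_⟩
  -- The coefficients of q need not be real, so self-adjointness of e comes instead from Ne = 0 and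
  -- 1 - e = Nd: ⟨ex, Ndy⟩ = ⟨Nex, dy⟩ = 0.
  · apply isHermitianFor_of_orthogonal
    intro x y
    change hermitian (𝓑.basis s) (e ≫ x) (y - e ≫ y) = 0
    have h1 : y - e ≫ y = N ≫ d ≫ y := by
      rw [← Category.assoc, ← hde, Preadditive.sub_comp, Category.id_comp]
    rw [h1, ← hTh1, reassoc_of% hTe1, Limits.zero_comp]
    simp [hermitian]
  · have h1 : f ≫ N = 0 := by
      simp only [N, T]
      rw [Preadditive.comp_sub, reassoc_of% hfa, reassoc_of% hfb, hfa, Category.comp_id, sub_self]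
    have h2 : f ≫ (𝟙 X - e) = 0 := by rw [hde, reassoc_of% h1, Limits.zero_comp]
    rw [Preadditive.comp_sub, Category.comp_id] at h2
    exact (sub_eq_zero.1 h2).symm

end Linear

/-! ### Meets by intersection, the chain condition, and joins -/

section Lattice

variable {C : Type u} [Category.{v} C] [Abelian C] [Linear ℂ C] [MonoidalCategory C]
  [MonoidalPreadditive C] [MonoidalLinear ℂ C] [RightRigidCategory C]
  {R : SimpleReps.{w} C} {X : C} [FrobeniusAlgebra X]

lemma isFrobeniusInclusion_pullback (hX : IsSemisimpleOfFiniteLength X)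
    (hSchur : ∀ S : C, Simple S → (∃ f : X ⟶ S, f ≠ 0) → ∀ e : S ⟶ S, ∃ c : ℂ, e = c • 𝟙 S)
    (𝓑 : ObjectBasis.{w'} R X) (A B : FrobeniusSubalgebra X)
    (hA : A.RigidInvariant 𝓑) (hB : B.RigidInvariant 𝓑)
    {D : C} {jA : D ⟶ A.obj} {jB : D ⟶ B.obj} (h : IsPullback jA jB A.incl B.incl) :
    ∃ (_ : FrobeniusAlgebra D) (hi : IsFrobeniusInclusion (jA ≫ A.incl)),
      (FrobeniusSubalgebra.mk D (jA ≫ A.incl) hi).RigidInvariant 𝓑 := by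
  obtain ⟨e, hea, heb, hed, heh, he⟩ := exists_projection_inf hX 𝓑 A.proj_proj B.proj_proj
    A.dualHom_proj B.dualHom_proj
    ((A.rigidInvariant_iff_actsHermitian hX hSchur 𝓑).1 hA)
    ((B.rigidInvariant_iff_actsHermitian hX hSchur 𝓑).1 hB)
  have hAm := A.isIncl.isMonHom
  have hBm := B.isIncl.isMonHom
  have hAi := A.isIncl.mono
  have hBi := B.isIncl.mono
  have hie : (jA ≫ A.incl) ≫ e = jA ≫ A.incl := by
    apply he
    · rw [Category.assoc, A.incl_proj]
    · rw [h.w, Category.assoc, B.incl_proj]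
  -- Both idempotents absorb e, so e factors through A and through B compatibly, hence through the
  -- pullback.
  let p : X ⟶ D := h.lift (e ≫ dualHom A.incl) (e ≫ dualHom B.incl) (by
    rw [Category.assoc, Category.assoc]
    exact hea.trans heb.symm)
  have hpi : p ≫ jA ≫ A.incl = e := by
    rw [← Category.assoc, h.lift_fst, Category.assoc]
    exact hea
  have hmono : Mono (jA ≫ A.incl) :=
    ⟨fun f g hfg => h.hom_ext
      (by rw [← cancel_mono A.incl, Category.assoc, Category.assoc, hfg])
      (by rw [← cancel_mono B.incl, Category.assoc, Category.assoc, ← h.w, hfg])⟩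
  have hip : (jA ≫ A.incl) ≫ p = 𝟙 D := by
    rw [← cancel_mono (jA ≫ A.incl), Category.assoc, hpi, hie, Category.id_comp]
  let one : 𝟙_ C ⟶ D := h.lift η[A.obj] η[B.obj] (by rw [IsMonHom.one_hom, IsMonHom.one_hom])
  let mul : D ⊗ D ⟶ D := h.lift ((jA ⊗ₘ jA) ≫ μ[A.obj]) ((jB ⊗ₘ jB) ≫ μ[B.obj]) (by
    rw [Category.assoc, Category.assoc, IsMonHom.mul_hom, IsMonHom.mul_hom,
      tensorHom_comp_tensorHom_assoc, tensorHom_comp_tensorHom_assoc, h.w])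
  have hone : one ≫ jA ≫ A.incl = η[X] := by
    rw [← Category.assoc, h.lift_fst, IsMonHom.one_hom]
  have hmul : mul ≫ jA ≫ A.incl = ((jA ≫ A.incl) ⊗ₘ (jA ≫ A.incl)) ≫ μ[X] := by
    rw [← Category.assoc, h.lift_fst, Category.assoc, IsMonHom.mul_hom,
      tensorHom_comp_tensorHom_assoc]
  generalize hi : jA ≫ A.incl = i at *
  let _ : MonObj D :=
    { one := one
      mul := mul
      one_mul := by
        rw [← cancel_mono i, Category.assoc, hmul, ← tensorHom_id,
          tensorHom_comp_tensorHom_assoc, hone, Category.id_comp, MonoidalCategory.tensorHom_def',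
          Category.assoc, MonObj.one_mul, leftUnitor_naturality]
      mul_one := by
        rw [← cancel_mono i, Category.assoc, hmul, ← id_tensorHom,
          tensorHom_comp_tensorHom_assoc, hone, Category.id_comp, MonoidalCategory.tensorHom_def,
          Category.assoc, MonObj.mul_one, rightUnitor_naturality]
      mul_assoc := by
        rw [← cancel_mono i]
        simp only [Category.assoc]
        rw [hmul, ← tensorHom_id, ← id_tensorHom, tensorHom_comp_tensorHom_assoc,
          tensorHom_comp_tensorHom_assoc, hmul, Category.id_comp]
        have e1 : (((i ⊗ₘ i) ≫ μ[X]) ⊗ₘ i) = ((i ⊗ₘ i) ⊗ₘ i) ≫ μ[X] ▷ X := by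
          rw [← tensorHom_id, tensorHom_comp_tensorHom, Category.comp_id]
        have e2 : (i ⊗ₘ ((i ⊗ₘ i) ≫ μ[X])) = (i ⊗ₘ (i ⊗ₘ i)) ≫ X ◁ μ[X] := by
          rw [← id_tensorHom, tensorHom_comp_tensorHom, Category.comp_id]
        rw [e1, e2, Category.assoc, Category.assoc, MonObj.mul_assoc,
          associator_naturality_assoc] }
  have hmon : IsMonHom i := ⟨hone, hmul⟩
  have hb : X ◁ (p ≫ i) ≫ μ[X] ≫ ε[X] = (p ≫ i) ▷ X ≫ μ[X] ≫ ε[X] := by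
    rw [hpi]
    exact (dualMap_eq_iff (A := X) (A' := X) (X := X) (X' := X) e e).1 hed
  obtain ⟨hd, hincl⟩ := isFrobeniusInclusion_of_retraction i p hip hb
  refine ⟨frobeniusOfRetraction i p hip hb, hincl, ?_⟩
  rw [FrobeniusSubalgebra.rigidInvariant_iff_actsHermitian hX hSchur 𝓑]
  have : (@FrobeniusSubalgebra.mk _ _ _ _ _ D (frobeniusOfRetraction i p hip hb) i hincl).proj
      = e := by
    rw [FrobeniusSubalgebra.proj, hd, hpi]
  rwa [this]

/-- The dimension of the space of endomorphisms of `X` with image in a Frobenius subalgebra is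
strictly monotone, so the Frobenius subalgebras satisfy the descending chain condition. -/
lemma wellFoundedLT_frobeniusSubalgebraPoset (hX : IsSemisimpleOfFiniteLength X)
    (𝓑 : ObjectBasis.{w'} R X) : WellFoundedLT (FrobeniusSubalgebraPoset X) := by
  have hfin : FiniteDimensional ℂ (X ⟶ X) := finiteDimensional_end_of_semisimple hX 𝓑
  let F (A : FrobeniusSubalgebra X) : Submodule ℂ (X ⟶ X) :=
    LinearMap.ker (Linear.rightComp ℂ X (A.proj - 𝟙 X))
  have hF : ∀ (A : FrobeniusSubalgebra X) (f : X ⟶ X), f ∈ F A ↔ f ≫ A.proj = f := fun A f => by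
    simp [F, sub_eq_zero]
  have hmono : ∀ A B : FrobeniusSubalgebra X, F A ≤ F B ↔ A.Contained B := fun A B => by
    rw [FrobeniusSubalgebra.contained_iff_proj]
    constructor
    · intro h
      -- The element `A.proj` of `F A` already tests containment.
      exact (hF B _).1 (h ((hF A _).2 A.proj_proj))
    · intro h f hf
      rw [hF] at hf ⊢
      rw [← hf, Category.assoc, h]
  let G : FrobeniusSubalgebraPoset X → Submodule ℂ (X ⟶ X) :=
    Quotient.lift F fun A B h =>
      le_antisymm ((hmono A B).2 h.contained) ((hmono B A).2 h.contained')
  have hG : StrictMono G := by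
    rintro ⟨A⟩ ⟨B⟩ hAB
    exact lt_of_le_not_ge ((hmono A B).2 hAB.le) fun h => hAB.not_ge ((hmono B A).1 h)
  exact hG.wellFoundedLT

lemma FrobeniusSubalgebra.whole_rigidInvariant (hX : IsSemisimpleOfFiniteLength X)
    (hSchur : ∀ S : C, Simple S → (∃ f : X ⟶ S, f ≠ 0) → ∀ e : S ⟶ S, ∃ c : ℂ, e = c • 𝟙 S)
    (𝓑 : ObjectBasis.{w'} R X) : (FrobeniusSubalgebra.whole X).RigidInvariant 𝓑 := by
  rw [FrobeniusSubalgebra.rigidInvariant_iff_actsHermitian hX hSchur 𝓑]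
  have h : (FrobeniusSubalgebra.whole X).proj = 𝟙 X := by
    have : dualHom (𝟙 X) = 𝟙 X := dualMap_id
    exact (Category.comp_id _).trans this
  rw [h]
  intro s x y
  simp

/-- A minimal upper bound m is least: for another upper bound u, the meet of m and u is an upper
bound below m, so it equals m and m ≤ u. The top element provides an upper bound to start from. -/
lemma isLatticeOrder_of_isGLB {P : Type*} [PartialOrder P] [WellFoundedLT P]
    (h : ∀ a b : P, ∃ c, IsGLB {a, b} c) (t : P) (ht : ∀ a, a ≤ t) : IsLatticeOrder P := by
  refine ⟨h, fun a b => ?_⟩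
  obtain ⟨m, hm, hmin⟩ := wellFounded_lt.has_min (upperBounds {a, b})
    ⟨t, fun x _ => ht x⟩
  refine ⟨m, hm, fun u hu => ?_⟩
  obtain ⟨c, hc⟩ := h m u
  have hcm : c ≤ m := hc.1 (by simp)
  have hcu : c ≤ u := hc.1 (by simp)
  have hcb : c ∈ upperBounds {a, b} := fun x hx => hc.2 (by
    rintro y (rfl | rfl)
    exacts [hm hx, hu hx])
  rcases hcm.lt_or_eq with hlt | rfl
  · exact absurd hlt (hmin c hcb)
  · exact hcu

end Lattice

end FrobLattice

end

theorem theorem5p11 {C : Type u} [Category.{v} C] [Abelian C] [Linear ℂ C]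
    [MonoidalCategory C] [MonoidalPreadditive C] [MonoidalLinear ℂ C] [RigidCategory C]
    (X : C) [FrobLattice.FrobeniusAlgebra X]
    (hX : FrobLattice.IsSemisimpleOfFiniteLength X)
    -- Schur's lemma: the simple quotients of `X` have scalar endomorphisms
    (hSchur : ∀ S : C, Simple S → (∃ f : X ⟶ S, f ≠ 0) → ∀ e : S ⟶ S, ∃ c : ℂ, e = c • 𝟙 S)
    (R : FrobLattice.SimpleReps.{w} C) (𝓑 : FrobLattice.ObjectBasis.{w'} R X) :
    FrobLattice.IsLatticeOrder (FrobLattice.FrobeniusBSubalgebraPoset 𝓑) ∧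
    ∀ (A B : FrobLattice.FrobeniusSubalgebra X)
      (hA : A.RigidInvariant 𝓑) (hB : B.RigidInvariant 𝓑)
      (D : C) (jA : D ⟶ A.obj) (jB : D ⟶ B.obj), IsPullback jA jB A.incl B.incl →
      ∃ (_ : FrobLattice.FrobeniusAlgebra D)
        (hi : FrobLattice.IsFrobeniusInclusion (jA ≫ A.incl))
        (hD : (FrobLattice.FrobeniusSubalgebra.mk D (jA ≫ A.incl) hi).RigidInvariant 𝓑),
        IsGLB {A.toBPoset hA, B.toBPoset hB}
          ((FrobLattice.FrobeniusSubalgebra.mk D (jA ≫ A.incl) hi).toBPoset hD) := by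
  have hglb : ∀ (A B : FrobLattice.FrobeniusSubalgebra X)
      (hA : A.RigidInvariant 𝓑) (hB : B.RigidInvariant 𝓑)
      (D : C) (jA : D ⟶ A.obj) (jB : D ⟶ B.obj), IsPullback jA jB A.incl B.incl →
      ∃ (_ : FrobLattice.FrobeniusAlgebra D)
        (hi : FrobLattice.IsFrobeniusInclusion (jA ≫ A.incl))
        (hD : (FrobLattice.FrobeniusSubalgebra.mk D (jA ≫ A.incl) hi).RigidInvariant 𝓑),
        IsGLB {A.toBPoset hA, B.toBPoset hB}
          ((FrobLattice.FrobeniusSubalgebra.mk D (jA ≫ A.incl) hi).toBPoset hD) := by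
    intro A B hA hB D jA jB h
    obtain ⟨hF, hi, hD⟩ :=
      FrobLattice.isFrobeniusInclusion_pullback hX hSchur 𝓑 A B hA hB h
    refine ⟨hF, hi, hD, ?_, ?_⟩
    · rintro x (rfl | rfl)
      · exact FrobLattice.FrobeniusSubalgebra.contained_of_fac jA rfl
      · exact FrobLattice.FrobeniusSubalgebra.contained_of_fac jB h.w
    · rintro ⟨⟨E⟩, hE⟩ hx
      obtain ⟨f, -, hf, -⟩ : E.Contained A := hx (Set.mem_insert _ _)
      obtain ⟨g, -, hg, -⟩ : E.Contained B := hx (Set.mem_insert_of_mem _ rfl)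
      exact FrobLattice.FrobeniusSubalgebra.contained_of_fac (h.lift f g (hf.symm.trans hg))
        (by rw [← Category.assoc, h.lift_fst, hf])
  refine ⟨?_, hglb⟩
  have := FrobLattice.wellFoundedLT_frobeniusSubalgebraPoset hX 𝓑
  refine FrobLattice.isLatticeOrder_of_isGLB ?_
    ((FrobLattice.FrobeniusSubalgebra.whole X).toBPoset
      (FrobLattice.FrobeniusSubalgebra.whole_rigidInvariant hX hSchur 𝓑)) ?_
  · rintro ⟨⟨A⟩, hA⟩ ⟨⟨B⟩, hB⟩
    obtain ⟨_, _, _, h⟩ := hglb A B hA hB _ _ _ (IsPullback.of_hasPullback A.incl B.incl)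
    exact ⟨_, h⟩
  · rintro ⟨⟨A⟩, hA⟩
    exact FrobLattice.FrobeniusSubalgebra.contained_of_fac A.incl (Category.comp_id _).symm
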